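/- **Theorem.** Let $I$ be a finite set of indivisible goods and $M\ge 1$ an integer. A *valuation* is a function $V:X\to\mathbb{R}$ on a nonempty set $X\subseteq\{0,1,\dots,M\}^I$; an agent with valuation $V$ has utility $x_0+V(\mathbf{x})$ for an amount $x_0\in\mathbb{R}$ of money and $\mathbf{x}\in X$. Given finitely many agents $j\in J$ with valuations $V^j:X^j\to\mathbb{R}$ and endowments $w^j_0\in\mathbb{R}$ of money and $\mathbf{w}^j\in X^j$ of goods, a *competitive equilibrium* consists of prices $\mathbf{p}\in\mathbb{R}^I$ and $\mathbf{x}^j\in X^j$ such that each $\mathbf{x}^j$ maximizes $w^j_0-\mathbf{p}\cdot(\mathbf{x}-\mathbf{w}^j)+V^j(\mathbf{x})$ over $\mathbf{x}\in X^j$, and $\sum_j\mathbf{x}^j=\sum_j\mathbf{w}^j$. For any real-valued function $V$ on a set $X\subseteq\mathbb{R}^K$ ($K$ finite), let $D_V(\mathbf{p})=\operatorname{argmax}_{\mathbf{x}\in X}\{V(\mathbf{x})-\mathbf{p}\cdot\mathbf{x}\}$ for $\mathbf{p}\in\mathbb{R}^K$. Call $i\in K$ *substitutable* (resp. *complementary*)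 to $k\in K$ for $V$ if, whenever $D_V(\mathbf{p})=\{\mathbf{x}\}$ and $\mathbf{p}'$ arises from $\mathbf{p}$ by lowering the price of $i$, there is $\mathbf{x}'\in D_V(\mathbf{p}')$ with $x'_k\le x_k$ (resp. $x'_k\ge x_k$). A *price effect* of $V$ is a nonzero vector $\Delta$ such that, for some $i$ and some such $\mathbf{p},\mathbf{p}',\mathbf{x}$, one has $\mathbf{x}+\Delta\in D_V(\mathbf{p}')$. A valuation $V$ is *unit-consistent* if, for the function $\overline V(\mathbf{y})=V(\pi(\mathbf{y}))$ on $\{\mathbf{y}\in\{0,1\}^{I\times\{1,\dots,M\}}:\pi(\mathbf{y})\in X\}$, where $\pi(\mathbf{y})_i=\sum_{m=1}^M y_{(i,m)}$, the items $(i,m)$ and $(i,m')$ are substitutable to each other for all $i\in I$ and $m\ne m'$. Let $\mathcal{V}$ be a set of valuations. A *bundling* is a set $\mathcal{B}\subseteq\{-1,0,1\}^I$ that is a basis of $\mathbb{R}^I$. A vector in $\{-1,0,1\}^I$ is *relevant* if it is a price effect of some $V\in\mathcal{V}$ or a standard basis vector. The set $\mathcal{V}$ is *bundle-consistent* if, for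 every bundling $\mathcal{B}$ consisting of relevant vectors and all $\mathbf{b},\mathbf{c}\in\mathcal{B}$, either $\mathbf{c}$ is substitutable to $\mathbf{b}$ for all of the functions $\mathbf{q}\mapsto V\big(\sum_{\mathbf{b}'\in\mathcal{B}}q_{\mathbf{b}'}\mathbf{b}'\big)$, $V\in\mathcal{V}$, or $\mathbf{c}$ is complementary to $\mathbf{b}$ for all of them; here $\mathbf{q}$ ranges over the vectors in $\mathbb{R}^{\mathcal{B}}$ for which the sum lies in the domain of $V$. Suppose that $\mathcal{V}$ is *invariant*: if $V\in\mathcal{V}$ and $\mathbf{p}\in\mathbb{R}^I_{\ge0}$, then $\mathbf{x}\mapsto V(\mathbf{x})+\mathbf{p}\cdot\mathbf{x}$ (on the domain of $V$) is in $\mathcal{V}$, and the zero function on $\{0,1\}^I$ is in $\mathcal{V}$. If a competitive equilibrium exists in every economy with finitely many agents whose valuations belong to $\mathcal{V}$, for all endowments, then every $V\in\mathcal{V}$ is unit-consistent and $\mathcal{V}$ is bundle-consistent. -/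

import Mathlib

namespace IndivisibleGoods

/-- A real-valued valuation `val : dom → ℝ` on a set `dom` of feasible quantity vectors in `ℝ^K`.
The commodities `K` will be goods, items (single units of goods), or the bundles of a bundling. -/
structure PartialValuation (K : Type*) where
  dom : Set (K → ℝ)
  val : dom → ℝ

/-- The price vector obtained from `p` by changing the price of commodity `i` to `r`. -/
noncomputable def setPrice {K : Type*} (p : K → ℝ) (i : K) (r : ℝ) : K → ℝ :=
  open Classical in Function.update p i r

namespace PartialValuation

variable {K : Type*}

/-- The quasilinear utility `x₀ + V(x)` of an amount `x₀` of money and a feasible vector `x`. -/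
def utility (V : PartialValuation K) (x₀ : ℝ) (x : V.dom) : ℝ := x₀ + V.val x

/-- Demand at the price vector `p`: the set of maximizers of `V(x) - p · x` over feasible `x`.
(For a quasilinear utility this is also Hicksian demand, at every utility level.) -/
def demand [Fintype K] (V : PartialValuation K) (p : K → ℝ) : Set (K → ℝ) :=
  {x | ∃ hx : x ∈ V.dom, ∀ y : V.dom, V.val y - ∑ k, p k * y.1 k ≤ V.val ⟨x, hx⟩ - ∑ k, p k * x k}

/-- For the agent with valuation `V`, commodity `i` is substitutable to commodity `k`. -/
def SubstitutableTo [Fintype K] (V : PartialValuation K) (i k : K) : Prop :=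
  ∀ (p x : K → ℝ), V.demand p = {x} → ∀ r < p i, ∃ x' ∈ V.demand (setPrice p i r), x' k ≤ x k

/-- For the agent with valuation `V`, commodity `i` is complementary to commodity `k`. -/
def ComplementaryTo [Fintype K] (V : PartialValuation K) (i k : K) : Prop :=
  ∀ (p x : K → ℝ), V.demand p = {x} → ∀ r < p i, ∃ x' ∈ V.demand (setPrice p i r), x k ≤ x' k

/-- `Δ` is a price effect for good `i` for the agent with valuation `V`. -/
def IsPriceEffect [Fintype K] (V : PartialValuation K) (i : K) (Δ : K → ℝ) : Prop :=
  Δ ≠ 0 ∧ ∃ (p x : K → ℝ) (r : ℝ), r < p i ∧ V.demand p = {x} ∧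
    x + Δ ∈ V.demand (setPrice p i r)

end PartialValuation

/-- A valuation of goods: its domain is a nonempty subset of `{0, 1, …, M}^I`. -/
structure GoodsValuation (I : Type*) (M : ℕ) extends PartialValuation I where
  dom_nonempty : dom.Nonempty
  dom_bounded : ∀ x ∈ dom, ∀ i, ∃ n : ℕ, n ≤ M ∧ x i = n

/-- The valuation `V₀ : {0, 1}^I → ℝ` that is identically zero. -/
def zeroValuation (I : Type*) {M : ℕ} (hM : 1 ≤ M) : GoodsValuation I M where
  dom := {x | ∀ i, x i = 0 ∨ x i = 1}
  val := fun _ => 0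
  dom_nonempty := ⟨fun _ => 0, fun _ => Or.inl rfl⟩
  dom_bounded := by
    intro x hx i
    rcases hx i with h | h
    · exact ⟨0, Nat.zero_le _, by simpa using h⟩
    · exact ⟨1, hM, by simpa using h⟩

namespace GoodsValuation

variable {I : Type*} {M : ℕ}

/-- The valuation `V'(x) = V(x) + p · x`, on the same domain as `V`. -/
noncomputable def addLinear [Fintype I] (V : GoodsValuation I M) (p : I → ℝ) :
    GoodsValuation I M where
  dom := V.dom
  val := fun x => V.val x + ∑ i, p i * x.1 i
  dom_nonempty := V.dom_nonempty
  dom_bounded := V.dom_bounded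

/-- The bundle of goods that corresponds to a bundle of items; `(i, m)` is the `m`-th unit of
good `i`. -/
def goodsOfItems (y : I × Fin M → ℝ) : I → ℝ := fun i => ∑ m : Fin M, y (i, m)

/-- The valuation of bundles of items, in `{0, 1}^(I × {1, …, M})`, induced by `V`. -/
def itemValuation (V : GoodsValuation I M) : PartialValuation (I × Fin M) where
  dom := {y | (∀ a, y a = 0 ∨ y a = 1) ∧ goodsOfItems y ∈ V.dom}
  val := fun y => V.val ⟨goodsOfItems y.1, y.2.2⟩

/-- Any two distinct units of the same good are substitutes (for each other). -/
def UnitConsistent [Fintype I] (V : GoodsValuation I M) : Prop :=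
  ∀ (i : I) (m m' : Fin M), m < m' →
    V.itemValuation.SubstitutableTo (i, m) (i, m') ∧
    V.itemValuation.SubstitutableTo (i, m') (i, m)

/-- The consumption vector `∑_{b ∈ B} q_b b` that corresponds to quantities `q` of bundles. -/
def goodsOfBundles (B : Finset (I → ℝ)) (q : B → ℝ) : I → ℝ := ∑ b : B, q b • b.1

/-- The valuation of quantity vectors `q ∈ ℝ^B` of bundles induced by `V`. Its demand is
bundled demand. -/
def bundledValuation (V : GoodsValuation I M) (B : Finset (I → ℝ)) : PartialValuation B where
  dom := {q | goodsOfBundles B q ∈ V.dom}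
  val := fun q => V.val ⟨goodsOfBundles B q.1, q.2⟩

end GoodsValuation

/-- `b ∈ {-1, 0, 1}^I`. -/
def IsSignVector {I : Type*} (b : I → ℝ) : Prop := ∀ i, b i = -1 ∨ b i = 0 ∨ b i = 1

/-- A bundling: a set of vectors in `{-1, 0, 1}^I` that is a basis of `ℝ^I`. -/
def IsBundling {I : Type*} (B : Finset (I → ℝ)) : Prop :=
  (∀ b ∈ B, IsSignVector b) ∧ LinearIndependent ℝ (fun b : B => b.1) ∧
    Submodule.span ℝ (B : Set (I → ℝ)) = ⊤

section Domains

variable {I : Type*} [Fintype I] {M : ℕ}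

/-- A bundle is relevant if it is in `{-1, 0, 1}^I` and either a price effect for some agent or
the bundle consisting of one unit of a single good. -/
def IsRelevant (𝒱 : Set (GoodsValuation I M)) (b : I → ℝ) : Prop :=
  IsSignVector b ∧
    ((∃ V ∈ 𝒱, ∃ i, V.IsPriceEffect i b) ∨
      ∃ i, b i = 1 ∧ ∀ k, k ≠ i → b k = 0)

/-- Bundle `b` is consistent with bundle `c`: either `c` is substitutable to `b` for all agents,
or `c` is complementary to `b` for all agents. -/
def ConsistentWith (𝒱 : Set (GoodsValuation I M)) (B : Finset (I → ℝ)) (b c : B) : Prop :=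
  (∀ V ∈ 𝒱, (V.bundledValuation B).SubstitutableTo c b) ∨
    (∀ V ∈ 𝒱, (V.bundledValuation B).ComplementaryTo c b)

/-- Any two bundles in any bundling that consists of relevant bundles are consistent. -/
def BundleConsistent (𝒱 : Set (GoodsValuation I M)) : Prop :=
  ∀ B : Finset (I → ℝ), IsBundling B → (∀ b ∈ B, IsRelevant 𝒱 b) →
    ∀ b c : B, ConsistentWith 𝒱 B b c

/-- A domain of valuations is invariant if it is closed under adding nonnegative linear functions
and contains the zero valuation on `{0, 1}^I`. -/
def IsInvariant (hM : 1 ≤ M) (𝒱 : Set (GoodsValuation I M)) : Prop :=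
  (∀ V ∈ 𝒱, ∀ p : I → ℝ, (∀ i, 0 ≤ p i) → V.addLinear p ∈ 𝒱) ∧ zeroValuation I hM ∈ 𝒱

/-- The price vector `p` and the allocation `x` form a competitive equilibrium of the economy in
which agent `j` has valuation `V j` and is endowed with money `w₀ j` and goods `w j`. -/
def IsCompetitiveEquilibrium {J : Type*} [Fintype J] (V : J → GoodsValuation I M)
    (w₀ : J → ℝ) (w : (j : J) → (V j).dom) (p : I → ℝ) (x : (j : J) → (V j).dom) : Prop :=
  (∀ (j : J) (y : (V j).dom),
    (V j).utility (w₀ j - ∑ i, p i * (y.1 i - (w j).1 i)) y ≤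
      (V j).utility (w₀ j - ∑ i, p i * ((x j).1 i - (w j).1 i)) (x j)) ∧
  ∑ j, (x j).1 = ∑ j, (w j).1

/-- Competitive equilibria exist in every economy with finitely many agents whose valuations are
in `𝒱`, whatever the endowments. -/
def EquilibriaExist (𝒱 : Set (GoodsValuation I M)) : Prop :=
  ∀ (J : Type) [Fintype J] (V : J → GoodsValuation I M), (∀ j, V j ∈ 𝒱) →
    ∀ (w₀ : J → ℝ) (w : (j : J) → (V j).dom),
      ∃ (p : I → ℝ) (x : (j : J) → (V j).dom), IsCompetitiveEquilibrium V w₀ w p x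

end Domains

end IndivisibleGoods

namespace IndivisibleGoods

open Filter Topology

/-! Existence for all endowments, combined with invariance, is a statement about Minkowski sums: an
integral vector in a sum of convex hulls of demand sets, at prices that may differ between agents,
already lies in the sum of the demand sets (`exists_mem_demand_sum_eq`). Personal prices are linear
terms in valuations, and agents with zero valuation make any integral total a feasible endowment.

Apply this to collinear demand sets, whose directions are edges. When linearly independent edges
combine to an integral vector, each summand is integral (`isIntegral_smul_of_linearIndependent`), a
form of unimodularity. Relevant vectors are edges (`IsRelevant.isEdge`). If bundle-consistency fails
for b and c, following demand along generic price lines (`GoodsValuation.exists_edge`) gives edges d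
and d' whose coordinates on (c, b) have signs (+, +) and (+, -). Unimodularity makes the two
coordinates of each edge equal in size. Exchanging b for d then doubles the c-coordinate of d', so a
multiple of d' with original c-coordinate 1/2 is integral; this is impossible because c has an entry
±1.

For unit-consistency, item prices become sellers' costs, and equilibrium yields one price per good.
If a cheaper item (i, m) forced demand for (i, m') up, the price of good i would rise, against the
law of demand. -/

theorem setPrice_eq {K : Type*} [DecidableEq K] (p : K → ℝ) (i : K) (r : ℝ) :
    setPrice p i r = p - (p i - r) • Pi.single i 1 := by
  ext k
  unfold setPrice
  by_cases h : k = i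
  · subst h; simp
  · simp [h]

/-! ### Integral vectors -/

section Integral

variable {I : Type*} {M : ℕ}

/-- A vector with integer coordinates. -/
def IsIntegral (x : I → ℝ) : Prop := ∀ i, ∃ n : ℤ, x i = n

theorem IsIntegral.add {x y : I → ℝ} (hx : IsIntegral x) (hy : IsIntegral y) :
    IsIntegral (x + y) := fun i => by
  obtain ⟨m, hm⟩ := hx i
  obtain ⟨n, hn⟩ := hy i
  exact ⟨m + n, by simp [hm, hn]⟩

theorem IsIntegral.sub {x y : I → ℝ} (hx : IsIntegral x) (hy : IsIntegral y) :
    IsIntegral (x - y) := fun i => by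
  obtain ⟨m, hm⟩ := hx i
  obtain ⟨n, hn⟩ := hy i
  exact ⟨m - n, by simp [hm, hn]⟩

theorem IsIntegral.sum {J : Type*} [Fintype J] {x : J → I → ℝ} (hx : ∀ j, IsIntegral (x j)) :
    IsIntegral (∑ j, x j) := fun i => by
  choose n hn using fun j => hx j i
  exact ⟨∑ j, n j, by simp [hn]⟩

theorem IsIntegral.intCast_smul {x : I → ℝ} (hx : IsIntegral x) (m : ℤ) :
    IsIntegral ((m : ℝ) • x) := fun i => by
  obtain ⟨n, hn⟩ := hx i
  exact ⟨m * n, by simp [hn]⟩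

theorem GoodsValuation.isIntegral_of_mem_dom (V : GoodsValuation I M) {x : I → ℝ}
    (hx : x ∈ V.dom) : IsIntegral x := fun i => by
  obtain ⟨n, -, hn⟩ := V.dom_bounded x hx i
  exact ⟨n, by simp [hn]⟩

end Integral

/-! ### Existence and upper hemicontinuity of demand -/

section Demand

variable {K : Type*} [Fintype K]

theorem PartialValuation.mem_demand_iff {V : PartialValuation K} {p x : K → ℝ} :
    x ∈ V.demand p ↔ ∃ hx : x ∈ V.dom, ∀ (y : K → ℝ) (hy : y ∈ V.dom),
      V.val ⟨y, hy⟩ - p ⬝ᵥ y ≤ V.val ⟨x, hx⟩ - p ⬝ᵥ x :=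
  ⟨fun ⟨hx, h⟩ => ⟨hx, fun y hy => h ⟨y, hy⟩⟩, fun ⟨hx, h⟩ => ⟨hx, fun y => h y.1 y.2⟩⟩

theorem PartialValuation.demand_nonempty {V : PartialValuation K} (hf : V.dom.Finite)
    (hne : V.dom.Nonempty) (p : K → ℝ) : (V.demand p).Nonempty := by
  have := hf.to_subtype
  have := hne.to_subtype
  obtain ⟨x, hx⟩ := Finite.exists_max (fun y : V.dom => V.val y - ∑ k, p k * y.1 k)
  exact ⟨x.1, x.2, hx⟩

/-- Each of the finitely many bundles that is strictly worse at `p` than a fixed maximizer stays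
strictly worse at nearby prices. -/
theorem PartialValuation.eventually_demand_subset {V : PartialValuation K} (hf : V.dom.Finite)
    (p : K → ℝ) : ∀ᶠ p' in 𝓝 p, V.demand p' ⊆ V.demand p := by
  rcases V.dom.eq_empty_or_nonempty with h0 | hne
  · refine Eventually.of_forall fun p' x hx => ?_
    have := hx.1
    simp [h0] at this
  obtain ⟨x0, hx0, hmax⟩ := PartialValuation.demand_nonempty hf hne p
  have := hf.to_subtype
  have key : ∀ᶠ p' in 𝓝 p, ∀ y : V.dom, y.1 ∉ V.demand p →
      V.val y - p' ⬝ᵥ y.1 < V.val ⟨x0, hx0⟩ - p' ⬝ᵥ x0 := by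
    rw [eventually_all]
    intro y
    by_cases hy : y.1 ∈ V.demand p
    · exact Eventually.of_forall fun _ h => absurd hy h
    · have hlt : V.val y - p ⬝ᵥ y.1 < V.val ⟨x0, hx0⟩ - p ⬝ᵥ x0 := by
        by_contra hcon
        push Not at hcon
        exact hy ⟨y.2, fun z => (hmax z).trans hcon⟩
      have h1 : Continuous fun p' : K → ℝ => V.val y - p' ⬝ᵥ y.1 := by
        unfold dotProduct; fun_prop
      have h2 : Continuous fun p' : K → ℝ => V.val ⟨x0, hx0⟩ - p' ⬝ᵥ x0 := by
        unfold dotProduct; fun_prop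
      filter_upwards [h1.continuousAt.eventually_lt h2.continuousAt hlt] with p' h _ using h
  filter_upwards [key] with p' h x hx
  by_contra hcon
  obtain ⟨hxd, hxm⟩ := PartialValuation.mem_demand_iff.1 hx
  exact absurd (h ⟨x, hxd⟩ hcon) (not_lt.2 (hxm x0 hx0))

end Demand

/-! ### From equilibrium existence to sums of demand sets -/

section Existence

variable {I : Type*} [Fintype I] {M : ℕ}

theorem GoodsValuation.dom_finite (V : GoodsValuation I M) : V.dom.Finite := by
  have h : (Set.pi Set.univ fun _ : I => Set.range fun n : Fin (M + 1) => (n : ℝ)).Finite :=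
    Set.Finite.pi fun _ => Set.finite_range _
  refine h.subset fun x hx i _ => ?_
  obtain ⟨n, hn, hxn⟩ := V.dom_bounded x hx i
  exact ⟨⟨n, by omega⟩, hxn.symm⟩

theorem GoodsValuation.demand_nonempty (V : GoodsValuation I M) (p : I → ℝ) :
    (V.demand p).Nonempty :=
  PartialValuation.demand_nonempty V.dom_finite V.dom_nonempty p

/-- Equilibria exist when the valuation of each agent `j` is shifted by the linear function
`σ j`. -/
theorem exists_shifted_equilibrium {hM : 1 ≤ M} {𝒱 : Set (GoodsValuation I M)}
    (hinv : IsInvariant hM 𝒱) (hex : EquilibriaExist 𝒱) {J : Type*} [Fintype J]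
    (V : J → GoodsValuation I M) (hV : ∀ j, V j ∈ 𝒱) (σ w : J → I → ℝ)
    (hw : ∀ j, w j ∈ (V j).dom) :
    ∃ (q : I → ℝ) (x : J → I → ℝ), (∀ j, x j ∈ (V j).demand (q - σ j)) ∧
      ∑ j, x j = ∑ j, w j := by
  classical
  let e := Fintype.equivFin J
  -- Invariance only permits nonnegative linear terms. Adding the same constant to every agent's
  -- term ensures this, and the prices absorb it.
  let c : ℝ := ∑ j, ∑ i, |σ j i|
  have hc : ∀ j i, 0 ≤ σ j i + c := by
    intro j i
    have h1 : |σ j i| ≤ ∑ i, |σ j i| :=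
      Finset.single_le_sum (f := fun i => |σ j i|) (fun _ _ => abs_nonneg _) (Finset.mem_univ i)
    have h2 : ∑ i, |σ j i| ≤ c :=
      Finset.single_le_sum (f := fun j => ∑ i, |σ j i|)
        (fun _ _ => Finset.sum_nonneg fun _ _ => abs_nonneg _) (Finset.mem_univ j)
    linarith [neg_abs_le (σ j i)]
  obtain ⟨q, x, hx, hsum⟩ := hex (Fin (Fintype.card J))
    (fun a => (V (e.symm a)).addLinear fun i => σ (e.symm a) i + c)
    (fun a => hinv.1 _ (hV _) _ (hc _)) (fun _ => 0) (fun a => ⟨w (e.symm a), hw _⟩)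
  refine ⟨q - fun _ => c, fun j => (x (e j)).1, fun j => ?_, ?_⟩
  · obtain ⟨a, rfl⟩ := e.symm.surjective j
    change (fun b => (x b).1) (e (e.symm a)) ∈ _
    rw [Equiv.apply_symm_apply, PartialValuation.mem_demand_iff]
    refine ⟨(x a).2, fun y hy => ?_⟩
    have := hx a ⟨y, hy⟩
    simp only [PartialValuation.utility, GoodsValuation.addLinear, mul_sub, add_mul,
      Finset.sum_sub_distrib, Finset.sum_add_distrib] at this
    change _ ≤ (V (e.symm a)).val (x a) - _
    simp only [dotProduct, Pi.sub_apply, sub_mul, Finset.sum_sub_distrib]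
    linarith
  · have h1 := e.sum_comp fun a => (x a).1
    have h2 := e.symm.sum_comp fun j => w j
    rw [h1, ← h2]
    exact hsum

/-- A supporting price of an allocation shows that any market-clearing convexified demand can be
replaced by a market-clearing selection from demand. -/
theorem exists_mem_demand_sum_eq_of_endowment {hM : 1 ≤ M} {𝒱 : Set (GoodsValuation I M)}
    (hinv : IsInvariant hM 𝒱) (hex : EquilibriaExist 𝒱) {J : Type*} [Fintype J]
    (V : J → GoodsValuation I M) (hV : ∀ j, V j ∈ 𝒱) (p y w : J → I → ℝ)
    (hy : ∀ j, y j ∈ convexHull ℝ ((V j).demand (p j))) (hw : ∀ j, w j ∈ (V j).dom)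
    (hyw : ∑ j, y j = ∑ j, w j) :
    ∃ x : J → I → ℝ, (∀ j, x j ∈ (V j).demand (p j)) ∧ ∑ j, x j = ∑ j, y j := by
  obtain ⟨q, x, hx, hsum⟩ := exists_shifted_equilibrium hinv hex V hV (fun j => - p j) w hw
  refine ⟨x, ?_, hsum.trans hyw.symm⟩
  choose m hm using fun j => (V j).demand_nonempty (p j)
  choose hmd hmm using fun j => PartialValuation.mem_demand_iff.1 (hm j)
  choose hxd hxm using fun j => PartialValuation.mem_demand_iff.1 (hx j)
  set c : J → ℝ := fun j => (V j).val ⟨m j, hmd j⟩ - p j ⬝ᵥ m j with hc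
  set u : J → ℝ := fun j => (V j).val ⟨x j, hxd j⟩ - p j ⬝ᵥ x j with hu
  -- With the shift `-p j`, the bundle `x j` is optimal at `q + p j`, so this bound holds at every
  -- point demanded at `p j`. It cuts out a half-space, hence extends to the hull. On summing over
  -- agents the `q` terms cancel, which forces `u j = c j`.
  have h1 : ∀ j, c j - q ⬝ᵥ y j ≤ u j - q ⬝ᵥ x j := by
    intro j
    have hconv : Convex ℝ {z : I → ℝ | c j - q ⬝ᵥ z ≤ u j - q ⬝ᵥ x j} := by
      have : IsLinearMap ℝ fun z : I → ℝ => q ⬝ᵥ z :=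
        ⟨dotProduct_add q, fun a z => dotProduct_smul a q z⟩
      have h := convex_halfSpace_ge this (c j - (u j - q ⬝ᵥ x j))
      have hset : {z : I → ℝ | c j - q ⬝ᵥ z ≤ u j - q ⬝ᵥ x j} =
          {z | c j - (u j - q ⬝ᵥ x j) ≤ q ⬝ᵥ z} := by
        ext z
        simp only [Set.mem_ofPred_eq]
        constructor <;> intro h <;> linarith
      rwa [hset]
    refine convexHull_min ?_ hconv (hy j)
    intro z hz
    obtain ⟨hzd, hzm⟩ := PartialValuation.mem_demand_iff.1 hz
    have e1 := hxm j z hzd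
    have e2 := hzm (m j) (hmd j)
    simp only [sub_neg_eq_add, add_dotProduct] at e1
    simp only [Set.mem_ofPred_eq, hc, hu]
    linarith
  have h2 : ∀ j, u j ≤ c j := fun j => hmm j _ (hxd j)
  have h3 : ∑ j, q ⬝ᵥ y j = ∑ j, q ⬝ᵥ x j := by
    rw [← dotProduct_sum, ← dotProduct_sum, hsum, hyw]
  have h4 : ∑ j, c j ≤ ∑ j, u j := by
    have := Finset.sum_le_sum fun j (_ : j ∈ Finset.univ) => h1 j
    simp only [Finset.sum_sub_distrib] at this
    linarith
  have h5 : ∀ j, u j = c j := by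
    have := (Finset.sum_eq_sum_iff_of_le fun j (_ : j ∈ Finset.univ) => h2 j).1
      (le_antisymm (Finset.sum_le_sum fun j _ => h2 j) h4)
    exact fun j => this j (Finset.mem_univ j)
  intro j
  rw [PartialValuation.mem_demand_iff]
  refine ⟨hxd j, fun z hz => ?_⟩
  have := h5 j
  simp only [hc, hu] at this
  rw [this]
  exact hmm j z hz

theorem mem_demand_zeroValuation_iff (hM : 1 ≤ M) {p x : I → ℝ} :
    x ∈ (zeroValuation I hM).demand p ↔
      (∀ i, x i = 0 ∨ x i = 1) ∧ ∀ i, (x i = 0 → 0 ≤ p i) ∧ (x i = 1 → p i ≤ 0) := by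
  classical
  rw [PartialValuation.mem_demand_iff]
  constructor
  · rintro ⟨hx, h⟩
    refine ⟨hx, fun i => ⟨fun h0 => ?_, fun h1 => ?_⟩⟩
    · have := h (x + Pi.single i 1) (fun k => by
        by_cases hk : k = i
        · subst hk; simp [h0]
        · simpa [hk] using hx k)
      simp [zeroValuation, dotProduct_add] at this
      linarith
    · have := h (x - Pi.single i 1) (fun k => by
        by_cases hk : k = i
        · subst hk; simp [h1]
        · simpa [hk] using hx k)
      simp [zeroValuation, dotProduct_sub] at this
      linarith
  · rintro ⟨hx, h⟩
    refine ⟨hx, fun y hy => ?_⟩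
    have : p ⬝ᵥ x ≤ p ⬝ᵥ y := by
      refine Finset.sum_le_sum fun i _ => ?_
      rcases hx i with h0 | h0 <;> rcases hy i with h1 | h1 <;> simp [h0, h1]
      · exact (h i).1 h0
      · exact (h i).2 h0
    simp only [zeroValuation]
    linarith

/-- An integral vector in the sum of the convex hulls of demand sets is in the sum of the demand
sets. -/
theorem exists_mem_demand_sum_eq {hM : 1 ≤ M} {𝒱 : Set (GoodsValuation I M)}
    (hinv : IsInvariant hM 𝒱) (hex : EquilibriaExist 𝒱) {J : Type*} [Fintype J]
    (V : J → GoodsValuation I M) (hV : ∀ j, V j ∈ 𝒱) (p y : J → I → ℝ)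
    (hy : ∀ j, y j ∈ convexHull ℝ ((V j).demand (p j))) (hint : IsIntegral (∑ j, y j)) :
    ∃ x : J → I → ℝ, (∀ j, x j ∈ (V j).demand (p j)) ∧ ∑ j, x j = ∑ j, y j := by
  choose w hw using fun j => (V j).dom_nonempty
  have hz : IsIntegral (∑ j, y j - ∑ j, w j) :=
    hint.sub (IsIntegral.sum fun j => (V j).isIntegral_of_mem_dom (hw j))
  choose z hz using hz
  let L : ℕ := ∑ i, (z i).natAbs
  have hL : ∀ i, (z i).natAbs ≤ L := fun i =>
    Finset.single_le_sum (f := fun i => (z i).natAbs) (fun _ _ => Nat.zero_le _)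
      (Finset.mem_univ i)
  -- At prices 1 and -1, auxiliary agents demand exactly 0 and exactly `d`. Endowing them with `w₀`
  -- and `w₁` supplies the positive and withholds the negative part of the discrepancy `z`.
  let d : Fin L → I → ℝ := fun _ _ => 1
  let w₀ : Fin L → I → ℝ := fun l i => if (l : ℤ) < z i then 1 else 0
  let w₁ : Fin L → I → ℝ := fun l i => if (l : ℤ) < - z i then 0 else 1
  have hcount : ∀ m : ℤ, m.natAbs ≤ L →
      ∑ l : Fin L, (if (l : ℤ) < m then (1 : ℝ) else 0) = (m.toNat : ℝ) := by
    intro m hm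
    rw [Fin.sum_univ_eq_sum_range (fun l => if (l : ℤ) < m then (1 : ℝ) else 0),
      Finset.sum_boole]
    congr 1
    have : (Finset.range L).filter (fun l : ℕ => (l : ℤ) < m) = Finset.range m.toNat := by
      ext l
      simp only [Finset.mem_filter, Finset.mem_range]
      omega
    rw [this, Finset.card_range]
  have hzero := hinv.2
  obtain ⟨x, hx, hsum⟩ := exists_mem_demand_sum_eq_of_endowment hinv hex
    (J := J ⊕ (Fin L ⊕ Fin L))
    (Sum.elim V fun _ => zeroValuation I hM)
    (by rintro (j | j) <;> simp [hV, hzero])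
    (Sum.elim p (Sum.elim (fun _ => fun _ => 1) (fun _ => fun _ => -1)))
    (Sum.elim y (Sum.elim (fun _ => 0) d))
    (Sum.elim w (Sum.elim w₀ w₁))
    (by
      rintro (j | j | j)
      · exact hy j
      · refine subset_convexHull ℝ _ ((mem_demand_zeroValuation_iff hM).2 ?_)
        simp
      · refine subset_convexHull ℝ _ ((mem_demand_zeroValuation_iff hM).2 ?_)
        simp [d])
    (by
      rintro (j | j | j)
      · exact hw j
      · intro i
        simp only [Sum.elim_inr, Sum.elim_inl, w₀]
        split_ifs <;> simp
      · intro i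
        simp only [Sum.elim_inr, w₁]
        split_ifs <;> simp)
    (by
      simp only [Fintype.sum_sum_type, Sum.elim_inl, Sum.elim_inr, Finset.sum_const_zero, zero_add]
      ext i
      have h1 := hcount (z i) (hL i)
      have h2 := hcount (- z i) (by rw [Int.natAbs_neg]; exact hL i)
      have h3 : ∑ l, w₁ l i = L - ∑ l : Fin L, (if (l : ℤ) < - z i then (1 : ℝ) else 0) := by
        rw [eq_sub_iff_add_eq, ← Finset.sum_add_distrib]
        have : ∀ l : Fin L, w₁ l i + (if (l : ℤ) < - z i then (1 : ℝ) else 0) = 1 := by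
          intro l
          simp only [w₁]
          split_ifs <;> simp
        simp [this]
      have h4 : ((z i).toNat : ℝ) - ((- z i).toNat : ℝ) = z i := by
        exact_mod_cast Int.toNat_sub_toNat_neg (z i)
      have h5 := hz i
      simp only [Pi.sub_apply, Pi.add_apply, Finset.sum_apply, d, w₀] at h5 ⊢
      rw [h3, h1, h2]
      simp
      linarith)
  refine ⟨fun j => x (Sum.inl j), fun j => hx (Sum.inl j), ?_⟩
  have ha : ∀ l : Fin L, x (Sum.inr (Sum.inl l)) = 0 := by
    intro l
    obtain ⟨h1, h2⟩ := (mem_demand_zeroValuation_iff hM).1 (hx (Sum.inr (Sum.inl l)))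
    ext i
    refine (h1 i).resolve_right fun h => ?_
    have := (h2 i).2 h
    norm_num at this
  have hb : ∀ l : Fin L, x (Sum.inr (Sum.inr l)) = d l := by
    intro l
    obtain ⟨h1, h2⟩ := (mem_demand_zeroValuation_iff hM).1 (hx (Sum.inr (Sum.inr l)))
    ext i
    refine (h1 i).resolve_left fun h => ?_
    have := (h2 i).1 h
    norm_num at this
  simpa [Fintype.sum_sum_type, ha, hb] using hsum

end Existence

/-! ### Units of the same good are substitutes -/

section UnitConsistency

variable {I : Type*} [Fintype I] {M : ℕ}

theorem GoodsValuation.itemValuation_dom_finite (V : GoodsValuation I M) :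
    V.itemValuation.dom.Finite := by
  have h : (Set.pi Set.univ fun _ : I × Fin M => ({0, 1} : Set ℝ)).Finite :=
    Set.Finite.pi fun _ => Set.toFinite _
  refine h.subset fun y hy a _ => ?_
  simpa using hy.1 a

theorem dotProduct_goodsOfItems (q : I → ℝ) (y : I × Fin M → ℝ) :
    q ⬝ᵥ GoodsValuation.goodsOfItems y = ∑ a, q a.1 * y a := by
  simp [dotProduct, GoodsValuation.goodsOfItems, Fintype.sum_prod_type, Finset.mul_sum]

/-- Item prices `p` are sellers' costs; a competitive equilibrium with the sellers gives prices
of goods that support an element of demand for items. -/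
theorem exists_item_equilibrium {hM : 1 ≤ M} {𝒱 : Set (GoodsValuation I M)}
    (hinv : IsInvariant hM 𝒱) (hex : EquilibriaExist 𝒱) {V : GoodsValuation I M} (hV : V ∈ 𝒱)
    (p : I × Fin M → ℝ) :
    ∃ (q : I → ℝ) (y : I × Fin M → ℝ), y ∈ V.itemValuation.demand p ∧
      GoodsValuation.goodsOfItems y ∈ V.demand q ∧
      ∀ a, (y a = 1 → p a ≤ q a.1) ∧ (y a = 0 → q a.1 ≤ p a) := by
  obtain ⟨w, hw⟩ := V.dom_nonempty
  choose n hnM hn using V.dom_bounded w hw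
  have hzero := hinv.2
  -- Agent `none` is the consumer and agent `some m` the seller of the `m`-th units. The sellers'
  -- endowments bring the total of every good to `M`, so the consumer receives exactly the units
  -- that sellers do not keep.
  obtain ⟨q, x, hx, hsum⟩ := exists_shifted_equilibrium hinv hex (J := Option (Fin M))
    (fun j => j.elim V fun _ => zeroValuation I hM)
    (by rintro (_ | j) <;> simp [hV, hzero])
    (fun j => j.elim 0 fun m i => p (i, m))
    (fun j => j.elim w fun m i => if (m : ℕ) < n i then 0 else 1)
    (by
      rintro (_ | j)
      · exact hw
      · intro i
        simp only [Option.elim_some]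
        split_ifs <;> simp)
  have hx0 : x none ∈ V.demand q := by simpa using hx none
  have hx1 := fun m => (mem_demand_zeroValuation_iff hM).1 (hx (some m))
  simp only [Option.elim_some, Pi.sub_apply] at hx1
  let y : I × Fin M → ℝ := fun a => 1 - x (some a.2) a.1
  have hy : ∀ a, y a = 0 ∨ y a = 1 := by
    intro a
    rcases (hx1 a.2).1 a.1 with h | h <;> simp [y, h]
  have hyq : ∀ a, (y a = 1 → p a ≤ q a.1) ∧ (y a = 0 → q a.1 ≤ p a) := by
    intro a
    obtain ⟨h1, h2⟩ := (hx1 a.2).2 a.1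
    refine ⟨fun h => ?_, fun h => ?_⟩
    · have := h1 (by simp only [y] at h; linarith)
      linarith
    · have := h2 (by simp only [y] at h; linarith)
      linarith
  have hgoods : GoodsValuation.goodsOfItems y = x none := by
    ext i
    have h := congrFun hsum i
    simp only [Fintype.sum_option, Option.elim_none, Option.elim_some,
      Finset.sum_apply] at h
    have hcount : ∑ m : Fin M, (if (m : ℕ) < n i then (0 : ℝ) else 1) = M - n i := by
      have h1 : ∑ m : Fin M, (if (m : ℕ) < n i then (1 : ℝ) else 0) = n i := by
        rw [Fin.sum_univ_eq_sum_range (fun l => if l < n i then (1 : ℝ) else 0),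
          Finset.sum_boole]
        congr 1
        have : (Finset.range M).filter (fun l : ℕ => l < n i) = Finset.range (n i) := by
          ext l
          have := hnM i
          simp only [Finset.mem_filter, Finset.mem_range]
          omega
        rw [this, Finset.card_range]
      rw [eq_sub_iff_add_eq, ← h1, ← Finset.sum_add_distrib]
      have : ∀ m : Fin M, (if (m : ℕ) < n i then (0 : ℝ) else 1) +
          (if (m : ℕ) < n i then (1 : ℝ) else 0) = 1 := by
        intro m
        split_ifs <;> simp
      simp [this]
    rw [hcount, hn i] at h
    simp only [GoodsValuation.goodsOfItems, y, Finset.sum_sub_distrib]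
    simp
    linarith
  refine ⟨q, y, ?_, by rwa [hgoods], hyq⟩
  obtain ⟨hxd, hxm⟩ := PartialValuation.mem_demand_iff.1 (hgoods ▸ hx0 :
    GoodsValuation.goodsOfItems y ∈ V.demand q)
  refine PartialValuation.mem_demand_iff.2 ⟨⟨hy, hxd⟩, fun y' hy' => ?_⟩
  have h1 := hxm _ hy'.2
  rw [dotProduct_goodsOfItems, dotProduct_goodsOfItems] at h1
  have h2 : ∑ a, (q a.1 - p a) * y' a ≤ ∑ a, (q a.1 - p a) * y a := by
    refine Finset.sum_le_sum fun a _ => ?_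
    rcases hy a with h | h <;> rcases hy'.1 a with h' | h' <;> simp [h, h']
    · exact (hyq a).2 h
    · exact (hyq a).1 h
  simp only [sub_mul, Finset.sum_sub_distrib] at h2
  simp only [GoodsValuation.itemValuation, dotProduct]
  linarith

/-- In an economy in which all equilibria exist, units of the same good are substitutes. -/
theorem itemValuation_substitutableTo {hM : 1 ≤ M} {𝒱 : Set (GoodsValuation I M)}
    (hinv : IsInvariant hM 𝒱) (hex : EquilibriaExist 𝒱) {V : GoodsValuation I M} (hV : V ∈ 𝒱)
    (i : I) {m m' : Fin M} (hmm : m ≠ m') :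
    V.itemValuation.SubstitutableTo (i, m) (i, m') := by
  classical
  intro p y hy r hr
  by_contra! hcon
  set p' := setPrice p (i, m) r with hp'
  rw [setPrice_eq] at hp'
  have hyp : y ∈ V.itemValuation.demand p := by simp [hy]
  obtain ⟨⟨hy01, hyd⟩, hym⟩ := PartialValuation.mem_demand_iff.1 hyp
  -- equilibrium after lowering the price of `(i, m)`
  obtain ⟨q', y', hy', hx', hq'⟩ := exists_item_equilibrium hinv hex hV p'
  have hgt := hcon y' hy'
  obtain ⟨⟨hy'01, hy'd⟩, hy'm⟩ := PartialValuation.mem_demand_iff.1 hy'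
  have hyi : y (i, m') = 0 ∧ y' (i, m') = 1 := by
    rcases hy01 (i, m') with h | h <;> rcases hy'01 (i, m') with h' | h' <;> rw [h, h'] at hgt <;>
      first | exact ⟨h, h'⟩ | norm_num at hgt
  -- Otherwise lowering the price of the item already bought would leave `y` optimal.
  have hym0 : y (i, m) = 0 := by
    refine (hy01 (i, m)).resolve_right fun h1 => ?_
    refine absurd (hcon y ?_) (lt_irrefl _)
    refine PartialValuation.mem_demand_iff.2 ⟨⟨hy01, hyd⟩, fun z hz => ?_⟩
    have e1 := hym z hz
    simp only [hp', sub_dotProduct, smul_dotProduct, single_one_dotProduct, h1, smul_eq_mul]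
    have : (p (i, m) - r) * z (i, m) ≤ (p (i, m) - r) * 1 := by
      refine mul_le_mul_of_nonneg_left ?_ (by linarith)
      rcases hz.1 (i, m) with h | h <;> simp [h]
    linarith
  -- a price of good `i` strictly below that of the unsold item `(i, m')`
  obtain ⟨q, hxq, hqi, hq⟩ : ∃ q : I → ℝ, GoodsValuation.goodsOfItems y ∈ V.demand q ∧
      q i < p (i, m') ∧ ∀ a, (y a = 1 → p a ≤ q a.1) ∧ (y a = 0 → q a.1 ≤ p a) := by
    -- A slightly cheaper `(i, m')` leaves `y` the only demanded bundle, and that item, still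
    -- unsold, bounds `q i` by the reduced price.
    have hcont : Tendsto (fun ε : ℝ => p - ε • Pi.single (i, m') (1 : ℝ)) (𝓝[>] 0) (𝓝 p) := by
      have : Continuous fun ε : ℝ => p - ε • Pi.single (i, m') (1 : ℝ) := by fun_prop
      have h := this.tendsto 0
      simp only [zero_smul, sub_zero] at h
      exact h.mono_left nhdsWithin_le_nhds
    obtain ⟨ε, hsub, hε⟩ := ((hcont.eventually
      (PartialValuation.eventually_demand_subset V.itemValuation_dom_finite p)).and
      self_mem_nhdsWithin).exists
    have hε : 0 < ε := hε
    obtain ⟨q, y₁, hy₁, hxq, hq⟩ := exists_item_equilibrium hinv hex hV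
      (p - ε • Pi.single (i, m') (1 : ℝ))
    obtain rfl : y₁ = y := by simpa [hy] using hsub hy₁
    have h0 := (hq (i, m')).2 hyi.1
    simp only [Pi.sub_apply, Pi.smul_apply, Pi.single_eq_same, smul_eq_mul, mul_one] at h0
    refine ⟨q, hxq, by linarith, fun a => ?_⟩
    by_cases ha : a = (i, m')
    · subst ha
      refine ⟨fun h => ?_, fun _ => by simp only; linarith⟩
      rw [hyi.1] at h
      norm_num at h
    · simpa [ha] using hq a
  have hlt : q i < q' i := by
    have := (hq' (i, m')).1 hyi.2
    have hne : p' (i, m') = p (i, m') := by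
      simp [hp', hmm.symm]
    simp only [hne] at this
    linarith
  obtain ⟨hd, hdm⟩ := PartialValuation.mem_demand_iff.1 hxq
  obtain ⟨hd', hdm'⟩ := PartialValuation.mem_demand_iff.1 hx'
  have e1 := hdm _ hd'
  have e2 := hdm' _ hd
  simp only [dotProduct_goodsOfItems] at e1 e2
  -- Optimality of the two bundles at `q` and `q'` makes this sum nonpositive. The sellers'
  -- conditions make it positive: only the cost of `(i, m)` changed, and that item was unsold
  -- before.
  have hpos : 0 < ∑ a : I × Fin M, (q' a.1 - q a.1) * (y' a - y a) := by
    refine Finset.sum_pos' (fun a _ => ?_) ⟨(i, m'), Finset.mem_univ _, ?_⟩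
    · by_cases ha : a = (i, m)
      · subst ha
        refine mul_nonneg (by simp only; linarith) ?_
        rcases hy'01 (i, m) with h | h <;> simp [h, hym0]
      · have hpa : p' a = p a := by simp [hp', ha]
        obtain ⟨h1, h2⟩ := hq a
        obtain ⟨h3, h4⟩ := hq' a
        rw [hpa] at h3 h4
        rcases hy01 a with h | h <;> rcases hy'01 a with h' | h' <;> simp [h, h']
        · exact (h2 h).trans (h3 h')
        · exact (h4 h').trans (h1 h)
    · simp only [hyi.1, hyi.2]
      linarith
  simp only [sub_mul, mul_sub, Finset.sum_sub_distrib] at hpos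
  linarith

end UnitConsistency

/-! ### Edge directions of demand sets -/

section Edges

variable {I : Type*} [Fintype I] {M : ℕ}

/-- An integral vector `d` is an edge direction for `𝒱` if some demand set lies on a line in the
direction `d` and spans a segment at least as long as `d`. -/
def IsEdge (𝒱 : Set (GoodsValuation I M)) (d : I → ℝ) : Prop :=
  IsIntegral d ∧ ∃ V ∈ 𝒱, ∃ (p x : I → ℝ) (t : ℝ), 1 ≤ t ∧ x ∈ V.demand p ∧
    x + t • d ∈ V.demand p ∧ ∀ y ∈ V.demand p, ∃ s : ℝ, y = x + s • d

theorem IsEdge.of_sub {𝒱 : Set (GoodsValuation I M)} {V : GoodsValuation I M} (hV : V ∈ 𝒱)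
    {p y z : I → ℝ} (hy : y ∈ V.demand p) (hz : z ∈ V.demand p)
    (h : ∀ w ∈ V.demand p, ∃ s : ℝ, w = y + s • (z - y)) : IsEdge 𝒱 (z - y) :=
  ⟨(V.isIntegral_of_mem_dom hz.1).sub (V.isIntegral_of_mem_dom hy.1), V, hV, p, y, 1, le_rfl, hy,
    by simpa using hz, h⟩

theorem IsEdge.single [DecidableEq I] {hM : 1 ≤ M} {𝒱 : Set (GoodsValuation I M)}
    (hinv : IsInvariant hM 𝒱) (i : I) : IsEdge 𝒱 (Pi.single i 1) := by
  refine ⟨fun k => ?_, _, hinv.2, 1 - Pi.single i 1, 0, 1, le_rfl, ?_, ?_, fun y hy => ?_⟩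
  · by_cases h : k = i
    · subst h; exact ⟨1, by simp⟩
    · exact ⟨0, by simp [h]⟩
  · rw [mem_demand_zeroValuation_iff]
    refine ⟨by simp, fun k => ?_⟩
    by_cases h : k = i
    · subst h; simp
    · simp [h]
  · rw [mem_demand_zeroValuation_iff]
    refine ⟨fun k => ?_, fun k => ?_⟩ <;> by_cases h : k = i <;> simp [h]
  · rw [mem_demand_zeroValuation_iff] at hy
    refine ⟨y i, ?_⟩
    ext k
    by_cases h : k = i
    · subst h; simp
    · have : y k = 0 := (hy.1 k).resolve_right fun h1 => by
        have := (hy.2 k).2 h1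
        simp [h] at this
        linarith
      simp [h, this]

/-- If an integral vector is a linear combination of linearly independent edge directions, each
of the summands is integral. -/
theorem isIntegral_smul_of_linearIndependent {hM : 1 ≤ M} {𝒱 : Set (GoodsValuation I M)}
    (hinv : IsInvariant hM 𝒱) (hex : EquilibriaExist 𝒱) {ι : Type*} [Fintype ι]
    {f : ι → I → ℝ} (hf : ∀ j, IsEdge 𝒱 (f j)) (hli : LinearIndependent ℝ f) (c : ι → ℝ)
    (hc : IsIntegral (∑ j, c j • f j)) (j : ι) : IsIntegral (c j • f j) := by
  choose hint V hV p x t ht hx hxt hline using hf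
  have hfloor : IsIntegral (∑ j, (⌊c j⌋ : ℝ) • f j) :=
    IsIntegral.sum fun j => (hint j).intCast_smul _
  have hfract : ∀ j, c j • f j = (⌊c j⌋ : ℝ) • f j + Int.fract (c j) • f j := fun j => by
    rw [← add_smul, Int.floor_add_fract]
  have hfr : IsIntegral (∑ j, Int.fract (c j) • f j) := by
    have : ∑ j, Int.fract (c j) • f j = ∑ j, c j • f j - ∑ j, (⌊c j⌋ : ℝ) • f j := by
      rw [eq_sub_iff_add_eq', ← Finset.sum_add_distrib]
      exact Finset.sum_congr rfl fun j _ => (hfract j).symm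
    rw [this]
    exact hc.sub hfloor
  -- Only fractional parts matter. Since `1 ≤ t j`, moving by the fractional part stays in the
  -- demanded segment; linear independence then identifies the integral selection `z j` with this
  -- point.
  obtain ⟨z, hz, hsum⟩ := exists_mem_demand_sum_eq hinv hex V hV p
    (fun j => x j + Int.fract (c j) • f j)
    (fun j => by
      have h0 := Int.fract_nonneg (c j)
      have h1 := (Int.fract_lt_one (c j)).le
      have htp : 0 < t j := by linarith [ht j]
      refine segment_subset_convexHull (hx j) (hxt j)
        ⟨1 - Int.fract (c j) / t j, Int.fract (c j) / t j, ?_, ?_, ?_, ?_⟩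
      · rw [sub_nonneg, div_le_one htp]
        linarith [ht j]
      · positivity
      · ring
      · ext i
        simp only [Pi.add_apply, Pi.smul_apply, smul_eq_mul]
        field_simp
        ring)
    (by
      rw [Finset.sum_add_distrib]
      exact (IsIntegral.sum fun j => (V j).isIntegral_of_mem_dom (hx j).1).add hfr)
  choose s hs using fun j => hline j (z j) (hz j)
  have h0 : ∑ j, (s j - Int.fract (c j)) • f j = 0 := by
    simp only [hs, Finset.sum_add_distrib, add_right_inj] at hsum
    simp only [sub_smul, Finset.sum_sub_distrib, hsum, sub_self]
  have hs' : s j = Int.fract (c j) := by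
    have := Fintype.linearIndependent_iff.1 hli _ h0 j
    linarith
  rw [hfract j]
  refine ((hint j).intCast_smul _).add ?_
  have : Int.fract (c j) • f j = z j - x j := by
    rw [hs j, hs']
    simp
  rw [this]
  exact ((V j).isIntegral_of_mem_dom (hz j).1).sub ((V j).isIntegral_of_mem_dom (hx j).1)

theorem dense_dotProduct_ne {g : I → ℝ} (hg : g ≠ 0) (κ : ℝ) :
    Dense {p : I → ℝ | p ⬝ᵥ g ≠ κ} := by
  intro p
  by_cases hp : p ⬝ᵥ g = κ
  · have hcont : Tendsto (fun ε : ℝ => p + ε • g) (𝓝[>] 0) (𝓝 p) := by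
      have : Continuous fun ε : ℝ => p + ε • g := by fun_prop
      have h := this.tendsto 0
      simp only [zero_smul, add_zero] at h
      exact h.mono_left nhdsWithin_le_nhds
    refine mem_closure_of_tendsto hcont ?_
    filter_upwards [self_mem_nhdsWithin] with ε hε
    have hε : 0 < ε := hε
    have hgg : g ⬝ᵥ g ≠ 0 := fun h => hg (dotProduct_self_eq_zero.1 h)
    simp [add_dotProduct, hp, hgg, hε.ne']
  · exact subset_closure hp

/-- If all bundles demanded after prices move in the direction `-c` have more of `l` than the
bundle demanded before, then some edge of a demand set increases both `c` and `l`. -/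
theorem GoodsValuation.exists_edge (V : GoodsValuation I M) {p x c l : I → ℝ} {t : ℝ}
    (ht : 0 < t) (hx : V.demand p = {x})
    (hl : ∀ x' ∈ V.demand (p - t • c), l ⬝ᵥ x < l ⬝ᵥ x') :
    ∃ p' y z, y ∈ V.demand p' ∧ z ∈ V.demand p' ∧ c ⬝ᵥ y < c ⬝ᵥ z ∧ l ⬝ᵥ y < l ⬝ᵥ z ∧
      ∀ w ∈ V.demand p', ∃ s : ℝ, w = y + s • (z - y) := by
  have hfin := V.dom_finite
  have := hfin.to_subtype
  -- If three bundles are all demanded at `q - s • c`, eliminating `s` from the two indifference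
  -- equations gives `q ⬝ᵥ g a = κ a`. A generic `q` avoids this whenever `g a ≠ 0`.
  let g : V.dom × V.dom × V.dom → I → ℝ := fun a =>
    (c ⬝ᵥ (a.2.2.1 - a.1.1)) • (a.2.1.1 - a.1.1) - (c ⬝ᵥ (a.2.1.1 - a.1.1)) • (a.2.2.1 - a.1.1)
  let κ : V.dom × V.dom × V.dom → ℝ := fun a =>
    (c ⬝ᵥ (a.2.2.1 - a.1.1)) * (V.val a.2.1 - V.val a.1) -
      (c ⬝ᵥ (a.2.1.1 - a.1.1)) * (V.val a.2.2 - V.val a.1)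
  have hdense : Dense (⋂ a : V.dom × V.dom × V.dom, {q : I → ℝ | g a ≠ 0 → q ⬝ᵥ g a ≠ κ a}) := by
    refine dense_iInter_of_isOpen (fun a => ?_) (fun a => ?_)
    · by_cases h : g a = 0
      · simp [h]
      · have : Continuous fun q : I → ℝ => q ⬝ᵥ g a := by unfold dotProduct; fun_prop
        simpa [h] using isOpen_ne_fun this continuous_const
    · by_cases h : g a = 0
      · simp [h]
      · simpa [h] using dense_dotProduct_ne h (κ a)
  have hnhds : ∀ᶠ q in 𝓝 p, V.demand q ⊆ V.demand p ∧
      V.demand (q - t • c) ⊆ V.demand (p - t • c) := by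
    refine (PartialValuation.eventually_demand_subset hfin p).and ?_
    have : Continuous fun q : I → ℝ => q - t • c := by fun_prop
    exact (this.tendsto p).eventually (PartialValuation.eventually_demand_subset hfin _)
  obtain ⟨q, hgen, hq0, hq1⟩ := hdense.inter_nhds_nonempty hnhds
  simp only [Set.mem_iInter, Set.mem_ofPred_eq] at hgen
  have hcurve : Continuous fun s : ℝ => q - s • c := by fun_prop
  -- At the last parameter in `A`, demand contains both a bundle with low `l` and one that survives
  -- just afterwards, necessarily with high `l`.
  let A : Set ℝ := {s | s ∈ Set.Icc 0 t ∧ ∃ y ∈ V.demand (q - s • c), l ⬝ᵥ y ≤ l ⬝ᵥ x}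
  have hAclosed : IsClosed A := by
    rw [← isOpen_compl_iff, isOpen_iff_mem_nhds]
    intro s hs
    by_cases hst : s ∈ Set.Icc 0 t
    · have hno : ∀ y ∈ V.demand (q - s • c), l ⬝ᵥ x < l ⬝ᵥ y := by
        intro y hy
        by_contra! h
        exact hs ⟨hst, y, hy, h⟩
      filter_upwards [(hcurve.tendsto s).eventually
        (PartialValuation.eventually_demand_subset hfin _)] with s' hs'
      rintro ⟨-, y, hy, hyl⟩
      exact absurd (hno y (hs' hy)) (not_lt.2 hyl)
    · filter_upwards [isClosed_Icc.isOpen_compl.mem_nhds hst] with s' hs' h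
      exact hs' h.1
  have hAcomp : IsCompact A := isCompact_Icc.of_isClosed_subset hAclosed fun s hs => hs.1
  have hA0 : (0 : ℝ) ∈ A := by
    refine ⟨⟨le_rfl, ht.le⟩, ?_⟩
    obtain ⟨y, hy⟩ := V.demand_nonempty q
    have : y = x := by simpa [hx] using hq0 hy
    exact ⟨y, by simpa using hy, by rw [this]⟩
  obtain ⟨s, ⟨⟨hs0, hst⟩, y, hy, hyl⟩, hmax⟩ := hAcomp.exists_isGreatest ⟨0, hA0⟩
  have hst' : s < t := by
    refine lt_of_le_of_ne hst ?_
    rintro rfl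
    exact absurd (hl y (hq1 hy)) (not_lt.2 hyl)
  have hev : ∀ᶠ s' in 𝓝[>] s, V.demand (q - s' • c) ⊆ V.demand (q - s • c) ∧ s' < t :=
    (((hcurve.tendsto s).eventually
      (PartialValuation.eventually_demand_subset hfin _)).and (Iio_mem_nhds hst')).filter_mono
      nhdsWithin_le_nhds
  obtain ⟨s', ⟨hsub, hs't⟩, hss'⟩ := (hev.and self_mem_nhdsWithin).exists
  have hss' : s < s' := hss'
  have hs'A : s' ∉ A := fun h => absurd (hmax h) (not_le.2 hss')
  obtain ⟨z, hz⟩ := V.demand_nonempty (q - s' • c)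
  have hzl : l ⬝ᵥ x < l ⬝ᵥ z := by
    by_contra! h
    exact hs'A ⟨⟨by linarith, hs't.le⟩, z, hz, h⟩
  have hys' : y ∉ V.demand (q - s' • c) := fun h => hs'A ⟨⟨by linarith, hs't.le⟩, y, h, hyl⟩
  have hz' := hsub hz
  obtain ⟨hyd, hym⟩ := PartialValuation.mem_demand_iff.1 hy
  obtain ⟨hzd, hzm⟩ := PartialValuation.mem_demand_iff.1 hz
  obtain ⟨_, hzm'⟩ := PartialValuation.mem_demand_iff.1 hz'
  have hcyz : c ⬝ᵥ y < c ⬝ᵥ z := by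
    by_contra! hle
    refine hys' (PartialValuation.mem_demand_iff.2 ⟨hyd, fun w hw => (hzm w hw).trans ?_⟩)
    have h1 := hym z hzd
    have h2 : (s' - s) * (c ⬝ᵥ z) ≤ (s' - s) * (c ⬝ᵥ y) :=
      mul_le_mul_of_nonneg_left hle (by linarith)
    simp only [sub_dotProduct, smul_dotProduct, smul_eq_mul] at h1 ⊢
    linarith
  refine ⟨q - s • c, y, z, hy, hz', hcyz, hyl.trans_lt hzl, fun w hw => ?_⟩
  obtain ⟨hwd, hwm⟩ := PartialValuation.mem_demand_iff.1 hw
  have hg : g (⟨y, hyd⟩, ⟨z, hzd⟩, ⟨w, hwd⟩) = 0 := by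
    by_contra hne
    refine hgen _ hne ?_
    have h1 := le_antisymm (hym z hzd) (hzm' y hyd)
    have h2 := le_antisymm (hym w hwd) (hwm y hyd)
    simp only [sub_dotProduct, smul_dotProduct, smul_eq_mul] at h1 h2
    simp only [g, κ, dotProduct_sub, dotProduct_smul, smul_eq_mul]
    linear_combination (c ⬝ᵥ z - c ⬝ᵥ y) * h2 - (c ⬝ᵥ w - c ⬝ᵥ y) * h1
  refine ⟨(c ⬝ᵥ (w - y)) / (c ⬝ᵥ (z - y)), ?_⟩
  have hne : c ⬝ᵥ (z - y) ≠ 0 := by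
    rw [dotProduct_sub]
    exact (sub_pos.2 hcyz).ne'
  have hg' : (c ⬝ᵥ (w - y)) • (z - y) = (c ⬝ᵥ (z - y)) • (w - y) := sub_eq_zero.1 hg
  rw [div_eq_inv_mul, mul_smul, hg', smul_smul, inv_mul_cancel₀ hne, one_smul]
  abel

/-- If `b i ≤ 0`, the new bundle would already have been optimal at the old prices, contrary to
uniqueness. -/
theorem GoodsValuation.IsPriceEffect.apply_pos {V : GoodsValuation I M} {i : I} {b : I → ℝ}
    (h : V.IsPriceEffect i b) : 0 < b i := by
  classical
  obtain ⟨hb, p, x, r, hr, hx, hxb⟩ := h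
  have hxp : x ∈ V.demand p := by simp [hx]
  obtain ⟨hxd, hxm⟩ := PartialValuation.mem_demand_iff.1 hxp
  obtain ⟨hxbd, hxbm⟩ := PartialValuation.mem_demand_iff.1 hxb
  by_contra! hle
  have : x + b ∈ V.demand p := by
    refine PartialValuation.mem_demand_iff.2 ⟨hxbd, fun w hw => (hxm w hw).trans ?_⟩
    have h1 := hxbm x hxd
    simp only [setPrice_eq, sub_dotProduct, smul_dotProduct, single_one_dotProduct, smul_eq_mul,
      Pi.add_apply] at h1
    have h2 : (p i - r) * b i ≤ 0 := mul_nonpos_of_nonneg_of_nonpos (by linarith) hle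
    linarith
  rw [hx] at this
  exact hb (by simpa using this)

/-- A price effect in `{-1, 0, 1}^I` is an edge direction. -/
theorem IsEdge.of_isPriceEffect {hM : 1 ≤ M} {𝒱 : Set (GoodsValuation I M)}
    (hinv : IsInvariant hM 𝒱) (hex : EquilibriaExist 𝒱) {V : GoodsValuation I M} (hV : V ∈ 𝒱)
    {i : I} {b : I → ℝ} (hsign : IsSignVector b) (hb : V.IsPriceEffect i b) : IsEdge 𝒱 b := by
  classical
  have hbi : b i = 1 := by
    have := GoodsValuation.IsPriceEffect.apply_pos hb
    rcases hsign i with h | h | h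
    · linarith
    · linarith
    · exact h
  obtain ⟨-, p, x, r, hr, hx, hxb⟩ := hb
  rw [setPrice_eq] at hxb
  -- Edges are normalized to have `i`-coordinate 1. Restricting to differences of bundles in `V.dom`
  -- keeps `E` finite, so its hull is closed.
  let E : Set (I → ℝ) := {e | ∃ d, IsEdge 𝒱 d ∧ 0 < d i ∧ e = (d i)⁻¹ • d ∧
    ∃ y ∈ V.dom, ∃ z ∈ V.dom, d = z - y}
  have hE : E.Finite := by
    refine ((V.dom_finite.prod V.dom_finite).image
      fun a => ((a.2 - a.1) i)⁻¹ • (a.2 - a.1)).subset ?_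
    rintro e ⟨d, -, -, rfl, y, hy, z, hz, rfl⟩
    exact ⟨(y, z), ⟨hy, hz⟩, rfl⟩
  have hbE : b ∈ convexHull ℝ E := by
    by_contra hnot
    obtain ⟨f, u, hfb, hfE⟩ := geometric_hahn_banach_point_closed (convex_convexHull ℝ E)
      (hE.isClosed_convexHull ℝ) hnot
    -- The resulting `l` is positive on `b` and negative on `E`. Tilting prices by `ε • l` makes
    -- every bundle demanded after the price cut gain in `l`, which produces an edge contradicting
    -- the separation.
    let φ : Module.Dual ℝ (I → ℝ) := u • LinearMap.proj i - f.toLinearMap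
    let l : I → ℝ := (dotProductEquiv ℝ I).symm φ
    have hl : ∀ v, l ⬝ᵥ v = u * v i - f v := by
      intro v
      have h := LinearMap.congr_fun ((dotProductEquiv ℝ I).apply_symm_apply φ) v
      exact h
    have hlb : 0 < l ⬝ᵥ b := by
      rw [hl, hbi]
      linarith
    have hcont : Tendsto (fun ε : ℝ => p - ε • l) (𝓝[>] 0) (𝓝 p) := by
      have : Continuous fun ε : ℝ => p - ε • l := by fun_prop
      have h := this.tendsto 0
      simp only [zero_smul, sub_zero] at h
      exact h.mono_left nhdsWithin_le_nhds
    obtain ⟨ε, hsub, hε⟩ := ((hcont.eventually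
      (PartialValuation.eventually_demand_subset V.dom_finite p)).and self_mem_nhdsWithin).exists
    have hε : 0 < ε := hε
    have hx' : V.demand (p - ε • l) = {x} := by
      rw [hx] at hsub
      exact (V.demand_nonempty _).subset_singleton_iff.1 hsub
    obtain ⟨hxbd, hxbm⟩ := PartialValuation.mem_demand_iff.1 hxb
    obtain ⟨p', y, z, hy, hz, hyi, hyl, hline⟩ := V.exists_edge (c := Pi.single i 1) (l := l)
      (sub_pos.2 hr) hx' fun x' hx' => by
        obtain ⟨hxd', hxm'⟩ := PartialValuation.mem_demand_iff.1 hx'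
        have h1 := hxm' _ hxbd
        have h2 := hxbm _ hxd'
        simp only [sub_dotProduct, smul_dotProduct, single_one_dotProduct, smul_eq_mul,
          dotProduct_add] at h1 h2
        have h3 : ε * (l ⬝ᵥ x + l ⬝ᵥ b) ≤ ε * (l ⬝ᵥ x') := by linarith
        have h4 := le_of_mul_le_mul_left h3 hε
        linarith
    simp only [single_one_dotProduct] at hyi
    have hdi : 0 < (z - y) i := by simpa using hyi
    have hmem : ((z - y) i)⁻¹ • (z - y) ∈ E :=
      ⟨z - y, .of_sub hV hy hz hline, hdi, rfl, y, hy.1, z, hz.1, rfl⟩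
    have h1 := hfE _ (subset_convexHull ℝ E hmem)
    have h2 : 0 < l ⬝ᵥ (z - y) := by
      rw [dotProduct_sub]
      linarith
    rw [hl] at h2
    rw [map_smul, smul_eq_mul, inv_mul_eq_div, lt_div_iff₀ hdi] at h1
    linarith
  -- By Carathéodory the points are affinely independent, and lying on the hyperplane where
  -- coordinate `i` is 1 makes them linearly independent. The weights are then positive integers
  -- with sum 1, so only one occurs.
  obtain ⟨ι, _, e, w, hrange, hai, hw0, hw1, hsum⟩ := eq_pos_convex_span_of_mem_convexHull hbE
  choose d hd hdi hed y hyd z hzd hdyz using fun j => hrange (Set.mem_range_self j)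
  have hei : ∀ j, e j i = 1 := fun j => by
    rw [hed j]
    simp [(hdi j).ne']
  have hlie : LinearIndependent ℝ e := by
    rw [Fintype.linearIndependent_iff]
    intro a ha j
    refine affineIndependent_iff.1 hai Finset.univ a ?_ ha j (Finset.mem_univ j)
    have := congrFun ha i
    simpa [hei] using this
  have hde : ∀ j, d j = d j i • e j := fun j => by
    rw [hed j, smul_smul, mul_inv_cancel₀ (hdi j).ne', one_smul]
  have hlid : LinearIndependent ℝ d := by
    rw [Fintype.linearIndependent_iff] at hlie ⊢
    intro a ha j
    have := hlie (fun j => a j * d j i) (by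
      rw [← ha]
      refine Finset.sum_congr rfl fun j _ => ?_
      rw [mul_smul, ← hde]) j
    exact (mul_eq_zero.1 this).resolve_right (hdi j).ne'
  have hwe : ∀ j, (w j * (d j i)⁻¹) • d j = w j • e j := fun j => by
    rw [mul_smul, ← hed j]
  have hwint : ∀ j, 1 ≤ w j := by
    intro j
    have h := isIntegral_smul_of_linearIndependent hinv hex hd hlid (fun j => w j * (d j i)⁻¹)
      (by
        simp only [hwe, hsum]
        intro k
        rcases hsign k with h | h | h
        · exact ⟨-1, by simp [h]⟩
        · exact ⟨0, by simp [h]⟩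
        · exact ⟨1, by simp [h]⟩) j
    rw [hwe] at h
    obtain ⟨n, hn⟩ := h i
    simp only [Pi.smul_apply, hei, smul_eq_mul, mul_one] at hn
    have := hw0 j
    rw [hn] at this ⊢
    exact_mod_cast this
  have hne : Nonempty ι := by
    by_contra h
    rw [not_nonempty_iff] at h
    simp at hw1
  obtain ⟨j⟩ := hne
  have huniq : ∀ k, k = j := by
    intro k
    by_contra hkj
    have : w k + w j ≤ ∑ j, w j := by
      rw [← Finset.sum_pair hkj]
      exact Finset.sum_le_sum_of_subset_of_nonneg (Finset.subset_univ _) fun m _ _ => (hw0 m).le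
    linarith [hwint k, hwint j]
  have hu : (Finset.univ : Finset ι) = {j} := by
    ext k
    simp [huniq k]
  rw [hu, Finset.sum_singleton] at hw1 hsum
  rw [hw1, one_smul] at hsum
  have hdb : d j = d j i • b := by rw [← hsum]; exact hde j
  obtain ⟨hdint, V', hV', p', x', t, ht, hx', hxt', hline⟩ := hd j
  have hdi1 : 1 ≤ d j i := by
    obtain ⟨n, hn⟩ := hdint i
    have := hdi j
    rw [hn] at this ⊢
    exact_mod_cast this
  -- The edge is a multiple of `b` by a factor at least 1, which the segment length absorbs.
  refine ⟨fun k => ?_, V', hV', p', x', t * d j i, one_le_mul_of_one_le_of_one_le ht hdi1, hx', ?_,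
    fun y hy => ?_⟩
  · rcases hsign k with h | h | h
    · exact ⟨-1, by simp [h]⟩
    · exact ⟨0, by simp [h]⟩
    · exact ⟨1, by simp [h]⟩
  · rw [mul_smul, ← hdb]
    exact hxt'
  · obtain ⟨s, hs⟩ := hline y hy
    exact ⟨s * d j i, by rw [mul_smul, ← hdb]; exact hs⟩

theorem IsRelevant.isEdge {hM : 1 ≤ M} {𝒱 : Set (GoodsValuation I M)}
    (hinv : IsInvariant hM 𝒱) (hex : EquilibriaExist 𝒱) {b : I → ℝ} (hb : IsRelevant 𝒱 b) :
    IsEdge 𝒱 b := by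
  classical
  obtain ⟨hsign, ⟨V, hV, i, hi⟩ | ⟨i, hi, hk⟩⟩ := hb
  · exact .of_isPriceEffect hinv hex hV hsign hi
  · have : b = Pi.single i 1 := by
      ext k
      by_cases h : k = i
      · subst h; simp [hi]
      · simp [h, hk k h]
    rw [this]
    exact .single hinv i

end Edges

/-! ### Coordinates and exchange in bases of edges -/

section Dual

variable {I : Type*} [Fintype I] {M : ℕ}

/-- The vectors `g` represent the coordinate functionals of the basis `f`. -/
structure IsDualPair {ι : Type*} [DecidableEq ι] (f g : ι → I → ℝ) : Prop where
  dotProduct_eq : ∀ i j, g i ⬝ᵥ f j = if i = j then 1 else 0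
  eq_zero : ∀ x, (∀ i, g i ⬝ᵥ x = 0) → x = 0

namespace IsDualPair

variable {ι : Type*} [DecidableEq ι] {f g : ι → I → ℝ}

theorem exchange (h : IsDualPair f g) (i : ι) {d : I → ℝ} (hd : g i ⬝ᵥ d ≠ 0) :
    IsDualPair (Function.update f i d)
      (Function.update (fun j => g j - (g j ⬝ᵥ d / g i ⬝ᵥ d) • g i) i ((g i ⬝ᵥ d)⁻¹ • g i)) where
  dotProduct_eq j k := by
    by_cases hj : j = i <;> by_cases hk : k = i
    · subst hj; subst hk; simp [hd]
    · subst hj; simp [hk, h.dotProduct_eq, Ne.symm hk]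
    · subst hk; simp [hj, hd, sub_dotProduct]
    · simp [hj, hk, h.dotProduct_eq, sub_dotProduct, Ne.symm hk]
  eq_zero x hx := by
    have hi : g i ⬝ᵥ x = 0 := by simpa [hd] using hx i
    refine h.eq_zero x fun j => ?_
    by_cases hj : j = i
    · rw [hj, hi]
    · simpa [hj, sub_dotProduct, hi] using hx j

variable [Fintype ι]

theorem dotProduct_sum_smul (h : IsDualPair f g) (c : ι → ℝ) (i : ι) :
    g i ⬝ᵥ ∑ j, c j • f j = c i := by
  simp [dotProduct_sum, dotProduct_smul, h.dotProduct_eq]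

theorem sum_smul (h : IsDualPair f g) (x : I → ℝ) : ∑ j, (g j ⬝ᵥ x) • f j = x := by
  refine sub_eq_zero.1 (h.eq_zero _ fun i => ?_)
  rw [dotProduct_sub, h.dotProduct_sum_smul, sub_self]

theorem linearIndependent (h : IsDualPair f g) : LinearIndependent ℝ f := by
  rw [Fintype.linearIndependent_iff]
  intro c hc i
  rw [← h.dotProduct_sum_smul c i, hc, dotProduct_zero]

theorem isIntegral_smul {hM : 1 ≤ M} {𝒱 : Set (GoodsValuation I M)}
    (hinv : IsInvariant hM 𝒱) (hex : EquilibriaExist 𝒱) (h : IsDualPair f g)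
    (hf : ∀ j, IsEdge 𝒱 (f j)) {x : I → ℝ} (hx : IsIntegral x) (j : ι) :
    IsIntegral ((g j ⬝ᵥ x) • f j) :=
  isIntegral_smul_of_linearIndependent hinv hex hf h.linearIndependent _ (by rwa [h.sum_smul]) j

/-- After exchanging `f i` for `d`, the vector `(g i ⬝ᵥ d)⁻¹ • d` is the `d`-component of the
integral vector `f i`. -/
theorem isIntegral_inv_smul {hM : 1 ≤ M} {𝒱 : Set (GoodsValuation I M)}
    (hinv : IsInvariant hM 𝒱) (hex : EquilibriaExist 𝒱) (h : IsDualPair f g)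
    (hf : ∀ j, IsEdge 𝒱 (f j)) {d : I → ℝ} (hd : IsEdge 𝒱 d) {i : ι} (hi : g i ⬝ᵥ d ≠ 0) :
    IsIntegral ((g i ⬝ᵥ d)⁻¹ • d) := by
  have hf' : ∀ j, IsEdge 𝒱 (Function.update f i d j) := fun j => by
    by_cases hj : j = i
    · subst hj; simpa using hd
    · simpa [hj] using hf j
  simpa [h.dotProduct_eq] using (h.exchange i hi).isIntegral_smul hinv hex hf' (hf i).1 i

/-- Nonzero coordinates of an edge direction with respect to a basis of edge directions with
entries in `{-1, 0, 1}` agree up to sign. -/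
theorem dotProduct_eq_or_eq_neg {hM : 1 ≤ M} {𝒱 : Set (GoodsValuation I M)}
    (hinv : IsInvariant hM 𝒱) (hex : EquilibriaExist 𝒱) (h : IsDualPair f g)
    (hf : ∀ j, IsEdge 𝒱 (f j)) (hsign : ∀ j, IsSignVector (f j)) {d : I → ℝ} (hd : IsEdge 𝒱 d)
    {i j : ι} (hi : g i ⬝ᵥ d ≠ 0) (hj : g j ⬝ᵥ d ≠ 0) :
    g i ⬝ᵥ d = g j ⬝ᵥ d ∨ g i ⬝ᵥ d = - (g j ⬝ᵥ d) := by
  -- An entry ±1 of `f j` turns an integral component into an integral coordinate. Both ratios are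
  -- thus integers with product 1.
  have hint : ∀ i j : ι, g i ⬝ᵥ d ≠ 0 → ∃ n : ℤ, g j ⬝ᵥ d / g i ⬝ᵥ d = n := by
    intro i j hi
    have hne : f j ≠ 0 := h.linearIndependent.ne_zero j
    obtain ⟨k, hk⟩ := Function.ne_iff.1 hne
    obtain ⟨n, hn⟩ := h.isIntegral_smul hinv hex hf (h.isIntegral_inv_smul hinv hex hf hd hi) j k
    simp only [dotProduct_smul, Pi.smul_apply, smul_eq_mul] at hn
    rcases hsign j k with h1 | h1 | h1
    · exact ⟨-n, by rw [h1] at hn; push_cast; rw [← hn]; ring⟩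
    · exact absurd h1 hk
    · exact ⟨n, by rw [h1] at hn; rw [← hn]; ring⟩
  obtain ⟨m, hm⟩ := hint i j hi
  obtain ⟨n, hn⟩ := hint j i hj
  have hnm : n * m = 1 := by
    have : (n * m : ℝ) = 1 := by
      rw [← hm, ← hn]
      field_simp
    exact_mod_cast this
  rw [div_eq_iff hj] at hn
  rcases Int.eq_one_or_neg_one_of_mul_eq_one hnm with h1 | h1 <;> simp [hn, h1]

/-- Two edge directions cannot have coordinates of equal sign and of opposite sign with respect
to the same two vectors of a basis of relevant vectors. -/
theorem not_exists_edges {hM : 1 ≤ M} {𝒱 : Set (GoodsValuation I M)}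
    (hinv : IsInvariant hM 𝒱) (hex : EquilibriaExist 𝒱) (h : IsDualPair f g)
    (hf : ∀ j, IsEdge 𝒱 (f j)) (hsign : ∀ j, IsSignVector (f j)) {d d' : I → ℝ}
    (hd : IsEdge 𝒱 d) (hd' : IsEdge 𝒱 d') {b c : ι} (hc : 0 < g c ⬝ᵥ d) (hb : 0 < g b ⬝ᵥ d)
    (hc' : 0 < g c ⬝ᵥ d') (hb' : g b ⬝ᵥ d' < 0) : False := by
  have hcb : c ≠ b := by
    rintro rfl
    exact lt_asymm hc' hb'
  have e1 : g c ⬝ᵥ d = g b ⬝ᵥ d :=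
    (h.dotProduct_eq_or_eq_neg hinv hex hf hsign hd hc.ne' hb.ne').resolve_right
      fun h => by linarith
  have e2 : g c ⬝ᵥ d' = - (g b ⬝ᵥ d') :=
    (h.dotProduct_eq_or_eq_neg hinv hex hf hsign hd' hc'.ne' hb'.ne).resolve_left
      fun h => by linarith
  have hf' : ∀ j, IsEdge 𝒱 (Function.update f b d j) := fun j => by
    by_cases hj : j = b
    · subst hj; simpa using hd
    · simpa [hj] using hf j
  have hval : Function.update (fun j => g j - (g j ⬝ᵥ d / g b ⬝ᵥ d) • g b) b
      ((g b ⬝ᵥ d)⁻¹ • g b) c ⬝ᵥ d' = 2 * g c ⬝ᵥ d' := by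
    simp only [Function.update_of_ne hcb, sub_dotProduct, smul_dotProduct, smul_eq_mul, e1,
      div_self hb.ne']
    linarith
  have hint := (h.exchange b hb.ne').isIntegral_inv_smul hinv hex hf' hd' (i := c)
    (by rw [hval]; positivity)
  rw [hval] at hint
  have hne : f c ≠ 0 := h.linearIndependent.ne_zero c
  obtain ⟨k, hk⟩ := Function.ne_iff.1 hne
  obtain ⟨n, hn⟩ := h.isIntegral_smul hinv hex hf hint c k
  -- In the original basis this integral multiple of `d'` has `c`-coordinate 1/2, while `f c` has an
  -- entry ±1.
  have hhalf : g c ⬝ᵥ ((2 * g c ⬝ᵥ d')⁻¹ • d') = 1 / 2 := by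
    rw [dotProduct_smul, smul_eq_mul]
    field_simp
  rw [hhalf, Pi.smul_apply, smul_eq_mul] at hn
  rcases hsign c k with h1 | h1 | h1
  · rw [h1] at hn
    have : (-1 : ℝ) = 2 * n := by linarith
    have : (-1 : ℤ) = 2 * n := by exact_mod_cast this
    omega
  · exact hk h1
  · rw [h1] at hn
    have : (1 : ℝ) = 2 * n := by linarith
    have : (1 : ℤ) = 2 * n := by exact_mod_cast this
    omega

end IsDualPair

end Dual

/-! ### Bundled demand and bundle-consistency -/

section Bundles

variable {I : Type*} [Fintype I] {M : ℕ}

theorem IsBundling.exists_dual [DecidableEq (I → ℝ)] {B : Finset (I → ℝ)} (hB : IsBundling B) :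
    ∃ g : B → I → ℝ, IsDualPair (fun b : B => b.1) g := by
  classical
  obtain ⟨-, hli, hspan⟩ := hB
  let e : Module.Basis B ℝ (I → ℝ) := Module.Basis.mk hli (by
    have : Set.range (fun b : B => b.1) = (B : Set (I → ℝ)) := by simp
    rw [this, hspan])
  have hg : ∀ (b : B) (x : I → ℝ), (dotProductEquiv ℝ I).symm (e.coord b) ⬝ᵥ x = e.coord b x :=
    fun b x => LinearMap.congr_fun ((dotProductEquiv ℝ I).apply_symm_apply (e.coord b)) x
  refine ⟨fun b => (dotProductEquiv ℝ I).symm (e.coord b), fun b b' => ?_, fun x hx => ?_⟩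
  · have : (b' : I → ℝ) = e b' := by simp [e]
    rw [hg, this, Module.Basis.coord_apply, Module.Basis.repr_self, Finsupp.single_apply]
    simp only [eq_comm]
  · refine e.forall_coord_eq_zero_iff.1 fun b => ?_
    rw [← hg]
    exact hx b

variable [DecidableEq (I → ℝ)] {B : Finset (I → ℝ)} {g : B → I → ℝ}

/-- Bundle prices correspond to goods prices through the dual basis, which preserves expenditure.
Cutting the price of one bundle moves goods prices along its dual vector. -/
theorem mem_demand_bundledValuation_iff (hg : IsDualPair (fun b : B => b.1) g)
    {V : GoodsValuation I M} {π q : B → ℝ} :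
    q ∈ (V.bundledValuation B).demand π ↔
      GoodsValuation.goodsOfBundles B q ∈ V.demand (∑ b, π b • g b) := by
  have hval : ∀ q : B → ℝ,
      (∑ b, π b • g b) ⬝ᵥ GoodsValuation.goodsOfBundles B q = π ⬝ᵥ q := by
    intro q
    have h : ∀ b, g b ⬝ᵥ GoodsValuation.goodsOfBundles B q = q b := hg.dotProduct_sum_smul q
    rw [sum_dotProduct]
    exact Finset.sum_congr rfl fun b _ => by rw [smul_dotProduct, h, smul_eq_mul]
  rw [PartialValuation.mem_demand_iff, PartialValuation.mem_demand_iff]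
  constructor
  · rintro ⟨hq, h⟩
    refine ⟨hq, fun y hy => ?_⟩
    obtain ⟨q', rfl⟩ : ∃ q', GoodsValuation.goodsOfBundles B q' = y :=
      ⟨fun b => g b ⬝ᵥ y, hg.sum_smul y⟩
    rw [hval, hval]
    exact h q' hy
  · rintro ⟨hq, h⟩
    refine ⟨hq, fun q' hq' => ?_⟩
    have := h _ hq'
    rwa [hval, hval] at this

/-- If lowering the price of the bundle `c` moves all demanded quantities of the bundle `b` in
one direction, some edge direction has coordinates of the corresponding signs. -/
theorem exists_isEdge_of_bundled_demand (hg : IsDualPair (fun b : B => b.1) g)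
    {𝒱 : Set (GoodsValuation I M)} {V : GoodsValuation I M} (hV : V ∈ 𝒱) {b c : B} (σ : ℝ)
    {π q : B → ℝ} {r : ℝ} (hq : (V.bundledValuation B).demand π = {q}) (hr : r < π c)
    (h : ∀ q' ∈ (V.bundledValuation B).demand (setPrice π c r), σ * q b < σ * q' b) :
    ∃ d, IsEdge 𝒱 d ∧ 0 < g c ⬝ᵥ d ∧ 0 < σ * g b ⬝ᵥ d := by
  have hcoord : ∀ q b, g b ⬝ᵥ GoodsValuation.goodsOfBundles B q = q b :=
    fun q => hg.dotProduct_sum_smul q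
  have hsurj : ∀ y, GoodsValuation.goodsOfBundles B (fun b => g b ⬝ᵥ y) = y := hg.sum_smul
  have hx : V.demand (∑ b, π b • g b) = {GoodsValuation.goodsOfBundles B q} := by
    ext y
    rw [← hsurj y, ← mem_demand_bundledValuation_iff hg, hq]
    simp only [Set.mem_singleton_iff]
    refine ⟨fun h => by rw [h], fun h => ?_⟩
    ext b
    have := congrArg (fun y => g b ⬝ᵥ y) h
    simpa only [hcoord] using this
  have hprice : ∑ b, setPrice π c r b • g b = ∑ b, π b • g b - (π c - r) • g c := by
    simp [setPrice_eq, sub_smul, Finset.sum_sub_distrib, Pi.single_apply]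
  obtain ⟨p', y, z, hy, hz, hcyz, hlyz, hline⟩ := V.exists_edge (c := g c) (l := σ • g b)
    (sub_pos.2 hr) hx fun x' hx' => by
      rw [← hprice, ← hsurj x', ← mem_demand_bundledValuation_iff hg] at hx'
      simpa only [smul_dotProduct, hcoord, smul_eq_mul] using h _ hx'
  refine ⟨z - y, .of_sub hV hy hz hline, ?_, ?_⟩
  · rw [dotProduct_sub]
    linarith
  · rw [dotProduct_sub]
    simp only [smul_dotProduct, smul_eq_mul] at hlyz
    linarith

theorem bundleConsistent_of_equilibriaExist {hM : 1 ≤ M} {𝒱 : Set (GoodsValuation I M)}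
    (hinv : IsInvariant hM 𝒱) (hex : EquilibriaExist 𝒱) : BundleConsistent 𝒱 := by
  classical
  intro B hB hrel b c
  obtain ⟨g, hg⟩ := hB.exists_dual
  by_contra hcon
  simp only [ConsistentWith, PartialValuation.SubstitutableTo, PartialValuation.ComplementaryTo,
    not_or, not_forall, not_exists, not_and, not_le] at hcon
  obtain ⟨⟨V, hV, π, q, hq, r, hr, h⟩, ⟨V', hV', π', q', hq', r', hr', h'⟩⟩ := hcon
  obtain ⟨d, hd, hcd, hbd⟩ := exists_isEdge_of_bundled_demand hg hV (b := b) 1 hq hr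
    fun q' hq' => by simpa using h q' hq'
  obtain ⟨d', hd', hcd', hbd'⟩ := exists_isEdge_of_bundled_demand hg hV' (b := b) (-1) hq' hr'
    fun q' hq' => by simpa using h' q' hq'
  exact hg.not_exists_edges hinv hex (fun b => (hrel b.1 b.2).isEdge hinv hex)
    (fun b => hB.1 b.1 b.2) hd hd' hcd (by linarith) hcd' (by linarith)

end Bundles
end IndivisibleGoods

theorem theorem4 {I : Type*} [Fintype I] {M : ℕ} (hM : 1 ≤ M)
    (𝒱 : Set (IndivisibleGoods.GoodsValuation I M))
    (hinv : IndivisibleGoods.IsInvariant hM 𝒱)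
    (hex : IndivisibleGoods.EquilibriaExist 𝒱) :
    (∀ V ∈ 𝒱, V.UnitConsistent) ∧ IndivisibleGoods.BundleConsistent 𝒱 := by
  classical
  exact ⟨fun _ hV i _ _ hmm =>
    ⟨IndivisibleGoods.itemValuation_substitutableTo hinv hex hV i hmm.ne,
      IndivisibleGoods.itemValuation_substitutableTo hinv hex hV i hmm.ne'⟩,
    IndivisibleGoods.bundleConsistent_of_equilibriaExist hinv hex⟩
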